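/- Let $n\ge 1$, let $\mathbb{M}_n$ be the algebra of complex $n\times n$ matrices and $\mathbb{M}_n^+$ its set of positive semidefinite matrices. For $X,Y\in\mathbb{M}_n^+$, one says that $X$ is weakly log-majorized by $Y$, written $X\prec_{w\log}Y$, if $$\prod_{j=1}^k\lambda_j(X)\le\prod_{j=1}^k\lambda_j(Y)\qquad\text{for } k=1,\dots,n,$$ where $\lambda_1(\cdot)\ge\dots\ge\lambda_n(\cdot)$ are the eigenvalues, counted with multiplicity, in decreasing order. A linear map $\Phi:\mathbb{M}_n\to\mathbb{M}_n$ is positive if $\Phi(\mathbb{M}_n^+)\subseteq\mathbb{M}_n^+$, and sub-unital if $\Phi(I)\le I$, i.e. $I-\Phi(I)\in\mathbb{M}_n^+$. Let $A,B\in\mathbb{M}_n^+$ and let $p\ge 1$ be a real number. Then, for every positive linear, sub-unital map $\Phi:\mathbb{M}_n\to\mathbb{M}_n$, $$(A\,\Phi(B)\,A)^p\prec_{w\log}A^p\,\Phi(B^p)\,A^p .$$ -/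

import Mathlib

open scoped MatrixOrder ComplexOrder

namespace Matrix

/-- The product `∏_{j=1}^k λ_j(X)` of the `k` largest eigenvalues, counted with multiplicity, of a
Hermitian matrix `X`; `eigenvalues₀` lists the eigenvalues in decreasing order. -/
noncomputable def IsHermitian.prodEigenvalues {n : ℕ} {X : Matrix (Fin n) (Fin n) ℂ}
    (hX : X.IsHermitian) (k : ℕ) : ℝ :=
  ∏ j ∈ Finset.univ.filter (fun j : Fin (Fintype.card (Fin n)) => (j : ℕ) < k),
    hX.eigenvalues₀ j

/-- `X` is weakly log-majorized by `Y`: both matrices are positive semidefinite and, for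
`k = 1, …, n`, the product of the `k` largest eigenvalues of `X` is at most that of `Y`. -/
def WeakLogMajorizedBy {n : ℕ} (X Y : Matrix (Fin n) (Fin n) ℂ) : Prop :=
  ∃ (hX : X.PosSemidef) (hY : Y.PosSemidef), ∀ k : ℕ, 1 ≤ k → k ≤ n →
    hX.isHermitian.prodEigenvalues k ≤ hY.isHermitian.prodEigenvalues k

end Matrix

/-! For positive semidefinite `X`, the product of the `k` largest eigenvalues is the operator norm
of the `k`-th compound (exterior power) of `X`. Weak log-majorization is thus one norm inequality
for each `k`, and compounds respect products, adjoints and real powers.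

For `1 ≤ p ≤ 2` two facts combine. The Cordes inequality for compounds replaces `(A Φ(B) A)^p` by
`A^p Φ(B)^p A^p` (`norm_compound_mul_mul_rpow_le`). The Jensen inequality `Φ(B)^p ≤ Φ(B^p)`
(`rpow_map_le_map_rpow`) then applies, because norms of compounds are monotone on positive matrices
(`norm_compound_mono`).

For `p > 2` this Jensen inequality fails in general, but the final estimate can be iterated:
exponent `p / 2` for `A, B`, then exponent `2` for `A^(p/2), B^(p/2)`. Repeated halving reaches
every `p`. -/

section
open scoped Matrix.Norms.L2Operator

/-! ### The Cordes inequality -/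

namespace CStarAlgebra
section
variable {𝓐 : Type*} [CStarAlgebra 𝓐] [PartialOrder 𝓐] [StarOrderedRing 𝓐]
open scoped NNReal

lemma smul_rpow (c : ℝ≥0) (a : 𝓐) (ha : 0 ≤ a) {s : ℝ} (hs : 0 ≤ s) :
    (c • a) ^ s = c ^ s • a ^ s := by
  rw [CFC.rpow_def, CFC.rpow_def, ← cfc_comp_smul c _ a (ha := ha), ← cfc_smul ..]
  exact cfc_congr fun x _ => NNReal.mul_rpow

lemma tendsto_add_algebraMap_rpow (a : 𝓐) (ha : 0 ≤ a) {s : ℝ} (hs : 0 < s) :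
    Filter.Tendsto (fun ε : ℝ => (a + algebraMap ℝ 𝓐 ε) ^ s) (nhdsWithin 0 (Set.Ioi 0))
      (nhds (a ^ s)) := by
  lift s to ℝ≥0 using hs.le
  have hs' : 0 < s := by exact_mod_cast hs
  simp only [← CFC.nnrpow_eq_rpow hs']
  have h := (CFC.continuousOn_nnrpow (A := 𝓐) s) a ha
  refine h.tendsto.comp (tendsto_nhdsWithin_iff.2 ⟨?_, ?_⟩)
  · have : Continuous fun ε : ℝ => a + algebraMap ℝ 𝓐 ε := by fun_prop
    simpa using (this.tendsto 0).mono_left nhdsWithin_le_nhds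
  · filter_upwards [self_mem_nhdsWithin] with ε hε
    exact add_nonneg ha (algebraMap_nonneg 𝓐 (le_of_lt hε))

lemma isStrictlyPositive_add_algebraMap (a : 𝓐) (ha : 0 ≤ a) {ε : ℝ} (hε : 0 < ε) :
    IsStrictlyPositive (a + algebraMap ℝ 𝓐 ε) := by
  apply IsStrictlyPositive.nonneg_add ha
  exact isStrictlyPositive_algebraMap hε

/-- The Cordes inequality for a strictly positive outer factor. -/
lemma norm_rpow_mul_rpow_mul_rpow_le_of_isStrictlyPositive {e f : 𝓐} (he : 0 ≤ e)
    (hf : IsStrictlyPositive f) {s : ℝ} (hs : 0 < s) (hs1 : s ≤ 1) :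
    ‖f ^ s * e ^ s * f ^ s‖ ≤ ‖f * e * f‖ ^ s := by
  have hconj : 0 ≤ f * e * f := hf.isSelfAdjoint.conjugate_nonneg he
  set c : ℝ≥0 := ‖f * e * f‖₊ with hc
  have hcr : ‖f * e * f‖ = c := rfl
  have h1 : f * e * f ≤ c • (1 : 𝓐) := by
    have := (CStarAlgebra.norm_le_iff_le_algebraMap (f * e * f) (norm_nonneg _) hconj).1 le_rfl
    rwa [Algebra.algebraMap_eq_smul_one] at this
  have hinv1 : f * f ^ (-1 : ℝ) = 1 := by
    simpa [CFC.rpow_one f hf.nonneg] using CFC.rpow_mul_rpow_neg (a := f) 1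
  have hinv2 : f ^ (-1 : ℝ) * f = 1 := by
    simpa [CFC.rpow_one f hf.nonneg] using CFC.rpow_neg_mul_rpow (a := f) 1
  -- Cancelling `f` isolates `e`, so that the operator monotonicity of `t ^ s` for `s ≤ 1`
  -- (Löwner–Heinz) can be applied to it.
  have h2 : e ≤ c • f ^ (-2 : ℝ) := by
    have hsa : IsSelfAdjoint (f ^ (-1 : ℝ)) := IsSelfAdjoint.of_nonneg CFC.rpow_nonneg
    have := hsa.conjugate_le_conjugate h1
    have e1 : f ^ (-1 : ℝ) * (f * e * f) * f ^ (-1 : ℝ) = e := by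
      calc _ = (f ^ (-1 : ℝ) * f) * e * (f * f ^ (-1 : ℝ)) := by noncomm_ring
        _ = e := by rw [hinv1, hinv2]; simp
    have e2 : f ^ (-1 : ℝ) * (c • (1 : 𝓐)) * f ^ (-1 : ℝ) = c • f ^ (-2 : ℝ) := by
      rw [mul_smul_comm, mul_one, smul_mul_assoc, ← CFC.rpow_add hf.isUnit]; norm_num
    rwa [e1, e2] at this
  have h3 : e ^ s ≤ c ^ s • f ^ (-2 * s) := by
    have := CFC.rpow_le_rpow ⟨hs.le, hs1⟩ h2
    rwa [smul_rpow c _ CFC.rpow_nonneg hs.le, CFC.rpow_rpow f (-2) s (by norm_num)] at this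
  have hsa : IsSelfAdjoint (f ^ s) := IsSelfAdjoint.of_nonneg CFC.rpow_nonneg
  have h4 := hsa.conjugate_le_conjugate h3
  have e3 : f ^ s * (c ^ s • f ^ (-2 * s)) * f ^ s = c ^ s • (1 : 𝓐) := by
    rw [mul_smul_comm, smul_mul_assoc, ← CFC.rpow_add hf.isUnit, ← CFC.rpow_add hf.isUnit,
      show s + -2 * s + s = 0 by ring, CFC.rpow_zero f hf.nonneg]
  rw [e3] at h4
  have h5 : 0 ≤ f ^ s * e ^ s * f ^ s := hsa.conjugate_nonneg CFC.rpow_nonneg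
  rw [CStarAlgebra.norm_le_iff_le_algebraMap _ (by positivity) h5, hcr,
    Algebra.algebraMap_eq_smul_one]
  exact h4

/-- The **Cordes inequality** in symmetric form. -/
lemma norm_rpow_mul_rpow_mul_rpow_le {e f : 𝓐} (he : 0 ≤ e) (hf : 0 ≤ f) {s : ℝ} (hs : 0 < s)
    (hs1 : s ≤ 1) : ‖f ^ s * e ^ s * f ^ s‖ ≤ ‖f * e * f‖ ^ s := by
  have hl := tendsto_add_algebraMap_rpow f hf hs
  have hr' : Filter.Tendsto (fun ε : ℝ => f + algebraMap ℝ 𝓐 ε) (nhdsWithin 0 (Set.Ioi 0))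
      (nhds f) := by
    have : Continuous fun ε : ℝ => f + algebraMap ℝ 𝓐 ε := by fun_prop
    simpa using (this.tendsto 0).mono_left nhdsWithin_le_nhds
  refine le_of_tendsto_of_tendsto ((hl.mul_const _).mul hl).norm
    ((((hr'.mul_const e).mul hr').norm).rpow_const (Or.inr hs.le)) ?_
  filter_upwards [self_mem_nhdsWithin] with ε hε
  exact norm_rpow_mul_rpow_mul_rpow_le_of_isStrictlyPositive he
    (isStrictlyPositive_add_algebraMap f hf hε) hs hs1
end
end CStarAlgebra

/-! ### Compound matrices, their powers and norms -/

namespace Matrix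
open Set Set.powersetCard

/-- The `k`-th compound matrix, whose entries are the `k × k` minors. -/
noncomputable def compound {n : ℕ} (k : ℕ) (A : Matrix (Fin n) (Fin n) ℂ) :
    Matrix (powersetCard (Fin n) k) (powersetCard (Fin n) k) ℂ :=
  LinearMap.toMatrix ((Pi.basisFun ℂ (Fin n)).exteriorPower k)
    ((Pi.basisFun ℂ (Fin n)).exteriorPower k) (exteriorPower.map k (toLin' A))

variable {n k : ℕ}

lemma compound_mul (A B : Matrix (Fin n) (Fin n) ℂ) :
    compound k (A * B) = compound k A * compound k B := by
  rw [compound, toLin'_mul, exteriorPower.map_comp, LinearMap.toMatrix_comp _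
    ((Pi.basisFun ℂ (Fin n)).exteriorPower k)]
  rfl

lemma compound_one : compound k (1 : Matrix (Fin n) (Fin n) ℂ) = 1 := by
  rw [compound, toLin'_one, exteriorPower.map_id, LinearMap.toMatrix_id]

lemma compound_apply (A : Matrix (Fin n) (Fin n) ℂ) (s t : powersetCard (Fin n) k) :
    compound k A s t =
      (A.submatrix (ofFinEmbEquiv.symm s) (ofFinEmbEquiv.symm t)).det := by
  rw [compound, LinearMap.toMatrix_apply, exteriorPower.basis_repr_apply,
    exteriorPower.basis_apply, exteriorPower.map_apply_ιMulti_family, exteriorPower.ιMulti_family,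
    exteriorPower.ιMultiDual_apply_ιMulti, ← det_transpose]
  congr 1
  ext i j
  simp

lemma compound_conjTranspose (A : Matrix (Fin n) (Fin n) ℂ) :
    compound k Aᴴ = (compound k A)ᴴ := by
  ext s t
  rw [conjTranspose_apply, compound_apply, compound_apply, ← det_conjTranspose]
  rfl

lemma prod_ofFinEmbEquiv_symm {M : Type*} [CommMonoid M] (s : powersetCard (Fin n) k)
    (d : Fin n → M) : ∏ i, d (ofFinEmbEquiv.symm s i) = ∏ i ∈ (s : Finset (Fin n)), d i := by
  have hs : (s : Finset (Fin n)).card = k := s.2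
  conv_rhs => rw [← Finset.map_orderEmbOfFin_univ (s : Finset (Fin n)) hs, Finset.prod_map]
  rfl

lemma compound_diagonal (d : Fin n → ℂ) :
    compound k (diagonal d) =
      diagonal fun s : powersetCard (Fin n) k => ∏ i ∈ (s : Finset (Fin n)), d i := by
  ext s t
  rw [compound_apply]
  by_cases h : s = t
  · subst h
    rw [diagonal_apply_eq, submatrix_diagonal _ _ (ofFinEmbEquiv.symm s).injective, det_diagonal,
      ← prod_ofFinEmbEquiv_symm]
    rfl
  · rw [diagonal_apply_ne _ h]
    obtain ⟨i, his, hit⟩ := (exists_mem_notMem_iff_ne s t).mp h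
    obtain ⟨l, rfl⟩ := (mem_range_ofFinEmbEquiv_symm_iff_mem s i).mpr his
    refine det_eq_zero_of_row_eq_zero l fun j => ?_
    rw [submatrix_apply, diagonal_apply_ne]
    intro hh
    exact hit (hh ▸ (mem_range_ofFinEmbEquiv_symm_iff_mem t _).mp ⟨j, rfl⟩)

lemma continuous_compound : Continuous (compound k : Matrix (Fin n) (Fin n) ℂ → _) := by
  refine continuous_matrix fun s t => ?_
  simp only [compound_apply]
  exact (continuous_id.matrix_submatrix _ _).matrix_det

lemma compound_nonneg {A : Matrix (Fin n) (Fin n) ℂ} (hA : 0 ≤ A) : 0 ≤ compound k A := by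
  obtain ⟨b, rfl⟩ := CStarAlgebra.nonneg_iff_eq_star_mul_self.1 hA
  rw [compound_mul, star_eq_conjTranspose, compound_conjTranspose, ← star_eq_conjTranspose]
  exact star_mul_self_nonneg _

lemma compound_mem_unitary {U : Matrix (Fin n) (Fin n) ℂ} (hU : U ∈ unitaryGroup (Fin n) ℂ) :
    compound k U ∈ unitaryGroup (powersetCard (Fin n) k) ℂ := by
  rw [mem_unitaryGroup_iff, star_eq_conjTranspose, ← compound_conjTranspose, ← compound_mul,
    ← star_eq_conjTranspose, mem_unitaryGroup_iff.1 hU, compound_one]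

open Polynomial in
lemma cfc_eq_aeval {ι : Type*} [Fintype ι] [DecidableEq ι] {X : Matrix ι ι ℂ}
    (hX : IsSelfAdjoint X) {f : ℝ → ℝ} {q : ℝ[X]}
    (h : ∀ x ∈ spectrum ℝ X, q.eval x = f x) : cfc f X = aeval X q := by
  rw [← cfc_polynomial q X]
  exact cfc_congr fun x hx => (h x hx).symm

open Polynomial in
lemma _root_.Set.Finite.exists_polynomial_eval_eq {S : Set ℝ} (hS : S.Finite) (f : ℝ → ℝ) :
    ∃ q : ℝ[X], ∀ x ∈ S, q.eval x = f x := by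
  classical
  refine ⟨Lagrange.interpolate hS.toFinset id f, fun x hx => ?_⟩
  exact Lagrange.eval_interpolate_at_node (v := id) f Function.injective_id.injOn
    (hS.mem_toFinset.2 hx)

open Polynomial in
lemma cfc_unitary_conj_diagonal {ι : Type*} [Fintype ι] [DecidableEq ι] (U : unitaryGroup ι ℂ)
    (d : ι → ℝ) (f : ℝ → ℝ) :
    cfc f ((U : Matrix ι ι ℂ) * diagonal (fun i => (d i : ℂ)) * star (U : Matrix ι ι ℂ)) =
      (U : Matrix ι ι ℂ) * diagonal (fun i => (f (d i) : ℂ)) * star (U : Matrix ι ι ℂ) := by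
  set X := (U : Matrix ι ι ℂ) * diagonal (fun i => (d i : ℂ)) * star (U : Matrix ι ι ℂ)
  have hX : IsSelfAdjoint X := by
    refine IsSelfAdjoint.conjugate ?_ _
    rw [isSelfAdjoint_iff, star_eq_conjTranspose, diagonal_conjTranspose]
    congr 1
    ext i
    simp
  -- Interpolating at the `d i` as well avoids having to identify the spectrum of `X`.
  obtain ⟨q, hq⟩ :=
    ((finite_real_spectrum (A := X)).union (Set.finite_range d)).exists_polynomial_eval_eq f
  rw [cfc_eq_aeval hX fun x hx => hq x (Or.inl hx)]
  have key : aeval X q =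
      (U : Matrix ι ι ℂ) * aeval (diagonal (fun i => (d i : ℂ))) q * star (U : Matrix ι ι ℂ) := by
    have := Polynomial.aeval_algHom_apply
      ((Unitary.conjStarAlgAut ℂ _ U).toAlgEquiv.toAlgHom.restrictScalars ℝ)
      (diagonal (fun i => (d i : ℂ))) q
    simpa using! this
  have key2 : aeval (diagonal (fun i => (d i : ℂ))) q = diagonal (fun i => (f (d i) : ℂ)) := by
    have := Polynomial.aeval_algHom_apply (diagonalAlgHom ℝ : (ι → ℂ) →ₐ[ℝ] _)
      (fun i => (d i : ℂ)) q
    simp only [diagonalAlgHom_apply] at this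
    rw [this]
    congr 1
    ext i
    rw [← hq (d i) (Or.inr ⟨i, rfl⟩)]
    have h1 := Polynomial.aeval_algHom_apply (Pi.evalAlgHom ℝ (fun _ : ι => ℂ) i)
      (fun i => (d i : ℂ)) q
    have h2 := Polynomial.aeval_algebraMap_apply ℂ (d i) q
    simp only [Pi.evalAlgHom_apply] at h1
    rw [← h1]
    simpa using! h2
  rw [key, key2]

lemma unitary_conj_diagonal_nonneg {ι : Type*} [Fintype ι] [DecidableEq ι] (U : unitaryGroup ι ℂ)
    {d : ι → ℝ} (hd : ∀ i, 0 ≤ d i) :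
    0 ≤ (U : Matrix ι ι ℂ) * diagonal (fun i => (d i : ℂ)) * star (U : Matrix ι ι ℂ) := by
  refine star_right_conjugate_nonneg ?_ _
  rw [nonneg_iff_posSemidef]
  exact PosSemidef.diagonal fun i => by simpa using hd i

lemma rpow_unitary_conj_diagonal {ι : Type*} [Fintype ι] [DecidableEq ι] (U : unitaryGroup ι ℂ)
    {d : ι → ℝ} (hd : ∀ i, 0 ≤ d i) (p : ℝ) :
    ((U : Matrix ι ι ℂ) * diagonal (fun i => (d i : ℂ)) * star (U : Matrix ι ι ℂ)) ^ p =
      (U : Matrix ι ι ℂ) * diagonal (fun i => ((d i ^ p : ℝ) : ℂ)) * star (U : Matrix ι ι ℂ) := by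
  rw [CFC.rpow_eq_cfc_real (unitary_conj_diagonal_nonneg U hd), cfc_unitary_conj_diagonal]

lemma PosSemidef.eq_unitary_conj_diagonal {ι : Type*} [Fintype ι] [DecidableEq ι] {X : Matrix ι ι ℂ}
    (hX : X.PosSemidef) :
    X = (hX.isHermitian.eigenvectorUnitary : Matrix ι ι ℂ) *
      diagonal (fun i => (hX.isHermitian.eigenvalues i : ℂ)) *
      star (hX.isHermitian.eigenvectorUnitary : Matrix ι ι ℂ) :=
  hX.isHermitian.spectral_theorem

lemma compound_unitary_conj_diagonal (U : unitaryGroup (Fin n) ℂ) (d : Fin n → ℝ) :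
    compound k ((U : Matrix (Fin n) (Fin n) ℂ) * diagonal (fun i => (d i : ℂ)) *
      star (U : Matrix (Fin n) (Fin n) ℂ)) =
    compound k (U : Matrix (Fin n) (Fin n) ℂ) *
      diagonal (fun s : powersetCard (Fin n) k => ((∏ i ∈ (s : Finset (Fin n)), d i : ℝ) : ℂ)) *
      star (compound k (U : Matrix (Fin n) (Fin n) ℂ)) := by
  simp only [compound_mul, compound_diagonal, star_eq_conjTranspose, compound_conjTranspose,
    Complex.ofReal_prod]

/-- In an eigenbasis of `X` the compound is diagonal, with products of eigenvalues as entries, and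
powers of nonnegative reals are multiplicative. -/
lemma compound_rpow {X : Matrix (Fin n) (Fin n) ℂ} (hX : X.PosSemidef) (p : ℝ) :
    compound k (X ^ p) = compound k X ^ p := by
  set U := hX.isHermitian.eigenvectorUnitary
  set d := hX.isHermitian.eigenvalues with hd
  have hd0 : ∀ i, 0 ≤ d i := hX.eigenvalues_nonneg
  have hXU : X = _ := PosSemidef.eq_unitary_conj_diagonal hX
  rw [hXU, rpow_unitary_conj_diagonal U hd0, compound_unitary_conj_diagonal,
    compound_unitary_conj_diagonal]
  have := rpow_unitary_conj_diagonal ⟨_, compound_mem_unitary (k := k) U.2⟩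
    (d := fun s : powersetCard (Fin n) k => ∏ i ∈ (s : Finset (Fin n)), d i)
    (fun s => Finset.prod_nonneg fun i _ => hd0 i) p
  rw [this]
  simp only [Real.finsetProd_rpow _ _ fun i _ => hd0 i]

lemma norm_unitary_conj_diagonal {ι : Type*} [Fintype ι] [DecidableEq ι] (U : unitaryGroup ι ℂ)
    (d : ι → ℂ) :
    ‖(U : Matrix ι ι ℂ) * diagonal d * star (U : Matrix ι ι ℂ)‖ = ‖d‖ := by
  rw [← Unitary.coe_star, CStarRing.norm_mul_coe_unitary, CStarRing.norm_coe_unitary_mul,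
    l2_opNorm_diagonal]

lemma _root_.Fin.filter_val_lt_eq_map_castLEEmb {m l : ℕ} (h : l ≤ m) :
    Finset.univ.filter (fun j : Fin m => (j : ℕ) < l) = Finset.univ.map (Fin.castLEEmb h) := by
  ext j
  simp only [Finset.mem_filter, Finset.mem_univ, true_and, Finset.mem_map, Fin.castLEEmb_apply]
  exact ⟨fun h => ⟨⟨j, h⟩, rfl⟩, by rintro ⟨i, rfl⟩; exact i.2⟩

lemma _root_.StrictMono.val_le_val_fin {l m : ℕ} {f : Fin l → Fin m} (hf : StrictMono f)
    (i : Fin l) : (i : ℕ) ≤ f i := by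
  obtain ⟨i, hi⟩ := i
  induction i with
  | zero => exact Nat.zero_le _
  | succ i ih =>
    exact (ih (Nat.lt_of_succ_lt hi)).trans_lt (hf (Fin.mk_lt_mk.2 (Nat.lt_succ_self i)))

/-- The product of the values of a nonnegative antitone sequence over a finset is at most the
product of its first values. -/
lemma _root_.Antitone.prod_le_prod_val_lt_card {m : ℕ} {f : Fin m → ℝ} (hf : Antitone f)
    (hf0 : ∀ i, 0 ≤ f i) (t : Finset (Fin m)) :
    ∏ i ∈ t, f i ≤ ∏ i ∈ Finset.univ.filter (fun j : Fin m => (j : ℕ) < t.card), f i := by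
  have htm : t.card ≤ m := by simpa using t.card_le_univ
  rw [Fin.filter_val_lt_eq_map_castLEEmb htm, Finset.prod_map]
  conv_lhs => rw [← Finset.map_orderEmbOfFin_univ t rfl, Finset.prod_map]
  exact Finset.prod_le_prod (fun i _ => hf0 _) fun i _ =>
    hf (Fin.le_def.2 ((t.orderEmbOfFin rfl).strictMono.val_le_val_fin i))

lemma norm_compound_eq_norm_prod_eigenvalues {X : Matrix (Fin n) (Fin n) ℂ}
    (hX : X.PosSemidef) :
    ‖compound k X‖ = ‖fun s : powersetCard (Fin n) k =>
      ((∏ i ∈ (s : Finset (Fin n)), hX.isHermitian.eigenvalues i : ℝ) : ℂ)‖ := by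
  set U := hX.isHermitian.eigenvectorUnitary
  have hXU : X = _ := PosSemidef.eq_unitary_conj_diagonal hX
  conv_lhs => rw [hXU, compound_unitary_conj_diagonal]
  exact norm_unitary_conj_diagonal ⟨_, compound_mem_unitary U.2⟩ _

lemma norm_compound_eq_prodEigenvalues {X : Matrix (Fin n) (Fin n) ℂ} (hX : X.PosSemidef)
    (hk : k ≤ n) : ‖compound k X‖ = hX.isHermitian.prodEigenvalues k := by
  set d := hX.isHermitian.eigenvalues with hd
  have hd0 : ∀ i, 0 ≤ d i := hX.eigenvalues_nonneg
  let e : Fin (Fintype.card (Fin n)) ≃ Fin n := Fintype.equivOfCardEq (Fintype.card_fin _)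
  have he : ∀ j, d (e j) = hX.isHermitian.eigenvalues₀ j := fun j => by
    simp [d, e, IsHermitian.eigenvalues]
  have h00 : ∀ j, 0 ≤ hX.isHermitian.eigenvalues₀ j := fun j => he j ▸ hd0 _
  have hP : 0 ≤ hX.isHermitian.prodEigenvalues k := Finset.prod_nonneg fun j _ => h00 j
  rw [norm_compound_eq_norm_prod_eigenvalues hX]
  apply le_antisymm
  · rw [pi_norm_le_iff_of_nonneg hP]
    intro s
    rw [Complex.norm_real, Real.norm_of_nonneg (Finset.prod_nonneg fun i _ => hd0 i)]
    have h1 : ∏ i ∈ (s : Finset (Fin n)), d i =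
        ∏ j ∈ (s : Finset (Fin n)).map e.symm.toEmbedding, hX.isHermitian.eigenvalues₀ j := by
      rw [Finset.prod_map]
      exact Finset.prod_congr rfl fun i _ => by rw [← he]; simp
    have h2 := hX.isHermitian.eigenvalues₀_antitone.prod_le_prod_val_lt_card h00
      ((s : Finset (Fin n)).map e.symm.toEmbedding)
    have hs : (s : Finset (Fin n)).card = k := s.2
    rw [Finset.card_map, hs] at h2
    rw [h1]
    exact h2
  -- The supremum is attained at the index set of the `k` largest eigenvalues; `e` is the reindexing
  -- between sorted eigenvalues and `Fin n`.
  · let T := (Finset.univ.filter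
      (fun j : Fin (Fintype.card (Fin n)) => (j : ℕ) < k)).map e.toEmbedding
    have hT : T.card = k := by
      rw [Finset.card_map, Fin.filter_val_lt_eq_map_castLEEmb (by simpa using hk),
        Finset.card_map, Finset.card_univ, Fintype.card_fin]
    have h1 : ∏ i ∈ T, d i = hX.isHermitian.prodEigenvalues k := by
      rw [Finset.prod_map, IsHermitian.prodEigenvalues]
      exact Finset.prod_congr rfl fun i _ => he i
    have h2 := norm_le_pi_norm (fun s : powersetCard (Fin n) k =>
      ((∏ i ∈ (s : Finset (Fin n)), d i : ℝ) : ℂ)) ⟨T, hT⟩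
    rw [Complex.norm_real, Real.norm_of_nonneg (Finset.prod_nonneg fun i _ => hd0 i)] at h2
    rw [← h1]
    exact h2

end Matrix

namespace Matrix
open Polynomial

/-! ### Operator Jensen inequalities -/

section Jensen
variable {ι κ : Type*} [Fintype ι] [DecidableEq ι] [Fintype κ] [DecidableEq κ]

lemma mul_aeval_conjTranspose_mul (T : Matrix κ ι ℂ) (q : ℝ[X]) :
    T * aeval (Tᴴ * T) q = aeval (T * Tᴴ) q * T := by
  induction q using Polynomial.induction_on' with
  | add p q hp hq => simp [Matrix.mul_add, Matrix.add_mul, hp, hq]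
  | monomial m a =>
    have h : ∀ m : ℕ, T * (Tᴴ * T) ^ m = (T * Tᴴ) ^ m * T := by
      intro m
      induction m with
      | zero => simp
      | succ m ih => rw [pow_succ, ← Matrix.mul_assoc, ih, pow_succ]; simp only [Matrix.mul_assoc]
    simp only [aeval_monomial, Algebra.algebraMap_eq_smul_one, smul_mul_assoc, one_mul,
      Matrix.mul_smul, Matrix.smul_mul, h]

lemma mul_cfc_conjTranspose_mul (T : Matrix κ ι ℂ) (f : ℝ → ℝ) :
    T * cfc f (Tᴴ * T) = cfc f (T * Tᴴ) * T := by
  -- A single polynomial must represent `f` on both spectra.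
  obtain ⟨q, hq⟩ := ((finite_real_spectrum (A := Tᴴ * T)).union
    (finite_real_spectrum (A := T * Tᴴ))).exists_polynomial_eval_eq f
  rw [cfc_eq_aeval (isHermitian_conjTranspose_mul_self T) fun x hx => hq x (Or.inl hx),
    cfc_eq_aeval (isHermitian_mul_conjTranspose_self T) fun x hx => hq x (Or.inr hx),
    mul_aeval_conjTranspose_mul]

/-- Split `x ^ p = x * x ^ (p - 1)` and move `T` through the functional calculus. For `p ≤ 2` the
remaining exponent is in the operator monotone range `[0, 1]`. -/
lemma rpow_conjTranspose_mul_self (T : Matrix κ ι ℂ) {p : ℝ} (hp : 1 ≤ p) :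
    (Tᴴ * T) ^ p = Tᴴ * (T * Tᴴ) ^ (p - 1) * T := by
  have h1 : 0 ≤ Tᴴ * T := nonneg_iff_posSemidef.2 (posSemidef_conjTranspose_mul_self T)
  have h2 : 0 ≤ T * Tᴴ := nonneg_iff_posSemidef.2 (posSemidef_self_mul_conjTranspose T)
  have hcont : ContinuousOn (fun x : ℝ => x ^ (p - 1)) (spectrum ℝ (Tᴴ * T)) :=
    (Real.continuous_rpow_const (by linarith)).continuousOn
  rw [CFC.rpow_eq_cfc_real h1, CFC.rpow_eq_cfc_real h2, Matrix.mul_assoc,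
    ← mul_cfc_conjTranspose_mul, ← Matrix.mul_assoc]
  conv_rhs => enter [1]; rw [← cfc_id' ℝ (Tᴴ * T) (IsSelfAdjoint.of_nonneg h1)]
  rw [← cfc_mul _ _ _ (by fun_prop) hcont]
  refine cfc_congr fun x hx => ?_
  have hx0 : 0 ≤ x := spectrum_nonneg_of_nonneg h1 hx
  show x ^ p = x * x ^ (p - 1)
  rcases hx0.eq_or_lt with rfl | hx0
  · rw [zero_mul, Real.zero_rpow (by linarith)]
  · rw [Real.rpow_sub_one hx0.ne']
    field_simp

lemma rpow_diagonal {d : ι → ℝ} (hd : ∀ i, 0 ≤ d i) (p : ℝ) :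
    (diagonal fun i => (d i : ℂ)) ^ p = diagonal fun i => ((d i ^ p : ℝ) : ℂ) := by
  simpa using rpow_unitary_conj_diagonal 1 hd p

lemma mul_conjTranspose_self_le_one {V : Matrix κ ι ℂ} (hV : Vᴴ * V ≤ 1) : V * Vᴴ ≤ 1 := by
  have h1 : 0 ≤ Vᴴ * V := nonneg_iff_posSemidef.2 (posSemidef_conjTranspose_mul_self V)
  have h2 : 0 ≤ V * Vᴴ := nonneg_iff_posSemidef.2 (posSemidef_self_mul_conjTranspose V)
  rw [← CStarAlgebra.norm_le_one_iff_of_nonneg _ h2]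
  rw [← CStarAlgebra.norm_le_one_iff_of_nonneg _ h1] at hV
  have h3 := l2_opNorm_conjTranspose_mul_self Vᴴ
  rw [conjTranspose_conjTranspose, l2_opNorm_conjTranspose,
    ← l2_opNorm_conjTranspose_mul_self] at h3
  rwa [h3]

/-- Hansen's inequality for a contraction and a nonnegative diagonal matrix. -/
lemma rpow_conjTranspose_mul_diagonal_mul_le {V : Matrix κ ι ℂ} (hV : Vᴴ * V ≤ 1) {d : κ → ℝ}
    (hd : ∀ i, 0 ≤ d i) {p : ℝ} (hp : 1 ≤ p) (hp2 : p ≤ 2) :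
    (Vᴴ * diagonal (fun i => (d i : ℂ)) * V) ^ p ≤
      Vᴴ * diagonal (fun i => ((d i ^ p : ℝ) : ℂ)) * V := by
  set S : Matrix κ κ ℂ := diagonal fun i => ((√(d i) : ℝ) : ℂ) with hS
  have hSH : Sᴴ = S := by
    rw [hS, diagonal_conjTranspose]
    congr 1
    ext i
    simp
  have hSS : S * S = diagonal fun i => (d i : ℂ) := by
    rw [hS, diagonal_mul_diagonal]
    congr 1
    ext i
    rw [← Complex.ofReal_mul, Real.mul_self_sqrt (hd i)]
  -- Here `V * Vᴴ ≤ 1` is conjugated by `S`, the square root of the diagonal matrix.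
  have hle : S * V * (S * V)ᴴ ≤ diagonal fun i => (d i : ℂ) := by
    have := (le_iff.1 (mul_conjTranspose_self_le_one hV)).mul_mul_conjTranspose_same S
    rw [le_iff, ← hSS]
    convert this using 1
    rw [conjTranspose_mul, hSH, Matrix.mul_sub, Matrix.sub_mul]
    simp only [Matrix.mul_assoc, Matrix.mul_one]
  have hpow := CFC.rpow_le_rpow (p := p - 1) ⟨by linarith, by linarith⟩ hle
  rw [rpow_diagonal hd] at hpow
  have hL : Vᴴ * diagonal (fun i => (d i : ℂ)) * V = (S * V)ᴴ * (S * V) := by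
    rw [conjTranspose_mul, hSH, ← hSS]
    simp only [Matrix.mul_assoc]
  have hR : Vᴴ * diagonal (fun i => ((d i ^ p : ℝ) : ℂ)) * V =
      (S * V)ᴴ * diagonal (fun i => ((d i ^ (p - 1) : ℝ) : ℂ)) * (S * V) := by
    have : S * diagonal (fun i => ((d i ^ (p - 1) : ℝ) : ℂ)) * S =
        diagonal (fun i => ((d i ^ p : ℝ) : ℂ)) := by
      rw [hS, diagonal_mul_diagonal, diagonal_mul_diagonal]
      congr 1
      ext i
      rw [← Complex.ofReal_mul, ← Complex.ofReal_mul, mul_right_comm, Real.mul_self_sqrt (hd i)]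
      congr 1
      rcases (hd i).eq_or_lt with h | h
      · rw [← h, zero_mul, Real.zero_rpow (by linarith)]
      · rw [Real.rpow_sub_one h.ne']
        field_simp
    rw [← this, conjTranspose_mul, hSH]
    simp only [Matrix.mul_assoc]
  rw [hL, hR, rpow_conjTranspose_mul_self _ hp, le_iff]
  have := (le_iff.1 hpow).conjTranspose_mul_mul_same (S * V)
  rwa [Matrix.mul_sub, Matrix.sub_mul] at this

/-- Jensen's operator inequality for the power functions with exponent in `[1, 2]` and a finite
family of positive matrices with sum at most one. -/
lemma rpow_sum_smul_le {Q : κ → Matrix ι ι ℂ} (hQ : ∀ i, 0 ≤ Q i) (hQ1 : ∑ i, Q i ≤ 1) {d : κ → ℝ}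
    (hd : ∀ i, 0 ≤ d i) {p : ℝ} (hp : 1 ≤ p) (hp2 : p ≤ 2) :
    (∑ i, (d i : ℂ) • Q i) ^ p ≤ ∑ i, ((d i ^ p : ℝ) : ℂ) • Q i := by
  -- The column of blocks `√(Q i)`: compressing a block-scalar diagonal by `V` gives the weighted
  -- sum of the `Q i`, which reduces the claim to Hansen's inequality.
  let V : Matrix (κ × ι) ι ℂ := of fun x b => CFC.sqrt (Q x.1) x.2 b
  have hV : ∀ e : κ → ℝ, Vᴴ * diagonal (fun x : κ × ι => (e x.1 : ℂ)) * V =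
      ∑ i, (e i : ℂ) • Q i := by
    intro e
    ext a b
    rw [Matrix.mul_assoc, mul_apply, Fintype.sum_prod_type, Matrix.sum_apply]
    refine Finset.sum_congr rfl fun i _ => ?_
    have hq : Q i = (CFC.sqrt (Q i))ᴴ * CFC.sqrt (Q i) := by
      rw [← star_eq_conjTranspose, (CFC.sqrt_nonneg (Q i)).star_eq,
        CFC.sqrt_mul_sqrt_self (Q i) (hQ i)]
    rw [smul_apply]
    conv_rhs => rw [hq]
    rw [mul_apply, Finset.smul_sum]
    refine Finset.sum_congr rfl fun j _ => ?_
    simp only [diagonal_mul, conjTranspose_apply, V, of_apply, smul_eq_mul]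
    ring
  have hV1 : Vᴴ * V ≤ 1 := by
    have := hV fun _ => 1
    simp only [Complex.ofReal_one, diagonal_one, Matrix.mul_one, one_smul] at this
    rwa [this]
  have := rpow_conjTranspose_mul_diagonal_mul_le hV1 (d := fun x : κ × ι => d x.1)
    (fun x => hd x.1) hp hp2
  rwa [hV d, hV fun i => d i ^ p] at this

/-- The **Choi–Davis–Jensen inequality** for positive sub-unital maps and the power functions with
exponent in `[1, 2]`. -/
lemma rpow_map_le_map_rpow (Φ : Matrix ι ι ℂ →ₚ[ℂ] Matrix κ κ ℂ) (hΦ : Φ 1 ≤ 1)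
    {B : Matrix ι ι ℂ} (hB : B.PosSemidef) {p : ℝ} (hp : 1 ≤ p) (hp2 : p ≤ 2) :
    Φ B ^ p ≤ Φ (B ^ p) := by
  set U := hB.isHermitian.eigenvectorUnitary
  set d := hB.isHermitian.eigenvalues with hd
  have hd0 : ∀ i, 0 ≤ d i := hB.eigenvalues_nonneg
  have hBU : B = (U : Matrix ι ι ℂ) * diagonal (fun i => (d i : ℂ)) * star (U : Matrix ι ι ℂ) :=
    PosSemidef.eq_unitary_conj_diagonal hB
  -- Rank-one spectral projections of `B`. Only their images under `Φ` matter, so positivity of `Φ`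
  -- suffices.
  let P : ι → Matrix ι ι ℂ := fun i =>
    (U : Matrix ι ι ℂ) * diagonal (fun j => (((if j = i then 1 else 0 : ℝ)) : ℂ)) *
      star (U : Matrix ι ι ℂ)
  have hP : ∀ i, 0 ≤ P i := fun i => unitary_conj_diagonal_nonneg U fun j => by positivity
  have hsum : ∀ e : ι → ℝ, (U : Matrix ι ι ℂ) * diagonal (fun i => (e i : ℂ)) *
      star (U : Matrix ι ι ℂ) = ∑ i, (e i : ℂ) • P i := by
    intro e
    have : diagonal (fun i => (e i : ℂ)) =
        ∑ i, (e i : ℂ) • diagonal (fun j => (((if j = i then 1 else 0 : ℝ)) : ℂ)) := by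
      ext a b
      rw [Matrix.sum_apply]
      by_cases hab : a = b
      · subst hab; simp [apply_ite Complex.ofReal]
      · simp [diagonal_apply_ne _ hab]
    rw [this]
    simp only [P, Matrix.mul_sum, Matrix.sum_mul, Matrix.mul_smul, Matrix.smul_mul]
  have hB1 : B = ∑ i, (d i : ℂ) • P i := hBU.trans (hsum d)
  have hB2 : B ^ p = ∑ i, ((d i ^ p : ℝ) : ℂ) • P i := by
    conv_lhs => rw [hBU, rpow_unitary_conj_diagonal U hd0]
    exact hsum _
  have hone : (1 : Matrix ι ι ℂ) = ∑ i, P i := by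
    have := hsum fun _ => 1
    simpa using this
  have hQ1 : ∑ i, Φ (P i) ≤ 1 := by rwa [← map_sum, ← hone]
  have := rpow_sum_smul_le (fun i => map_nonneg Φ (hP i)) hQ1 hd0 hp hp2
  rw [hB2, map_sum]
  conv_lhs => rw [hB1, map_sum]
  simpa only [map_smul] using this
end Jensen

/-! ### Norm inequalities for compounds and the doubling of exponents -/

section
variable {n k : ℕ}

lemma norm_compound_le_one {K : Matrix (Fin n) (Fin n) ℂ} (hK : 0 ≤ K) (hK1 : K ≤ 1) :
    ‖compound k K‖ ≤ 1 := by
  have hP := nonneg_iff_posSemidef.1 hK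
  have hd0 := hP.eigenvalues_nonneg
  have hd1 : ‖fun i => (hP.isHermitian.eigenvalues i : ℂ)‖ ≤ 1 := by
    rw [← norm_unitary_conj_diagonal hP.isHermitian.eigenvectorUnitary,
      ← PosSemidef.eq_unitary_conj_diagonal hP]
    exact (CStarAlgebra.norm_le_one_iff_of_nonneg K hK).2 hK1
  rw [norm_compound_eq_norm_prod_eigenvalues hP, pi_norm_le_iff_of_nonneg zero_le_one]
  intro s
  rw [Complex.norm_real, Real.norm_of_nonneg (Finset.prod_nonneg fun i _ => hd0 i)]
  refine Finset.prod_le_one (fun i _ => hd0 i) fun i _ => ?_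
  have := (norm_le_pi_norm _ i).trans hd1
  rwa [Complex.norm_real, Real.norm_of_nonneg (hd0 i)] at this

/-- With `R = √Y`, write `X = R K R` where `0 ≤ K ≤ 1`. The compound of `K` is a contraction, and
that of `R` has squared norm `‖compound k Y‖`. -/
lemma norm_compound_le_of_isStrictlyPositive {X Y : Matrix (Fin n) (Fin n) ℂ} (hX : 0 ≤ X)
    (hY : IsStrictlyPositive Y) (hXY : X ≤ Y) : ‖compound k X‖ ≤ ‖compound k Y‖ := by
  obtain ⟨R, R', hR, hR', hRR, h1, h2⟩ : ∃ R R' : Matrix (Fin n) (Fin n) ℂ,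
      IsSelfAdjoint R ∧ IsSelfAdjoint R' ∧ R * R = Y ∧ R * R' = 1 ∧ R' * R = 1 := by
    refine ⟨Y ^ (1 / 2 : ℝ), Y ^ (-(1 / 2) : ℝ), IsSelfAdjoint.of_nonneg CFC.rpow_nonneg,
      IsSelfAdjoint.of_nonneg CFC.rpow_nonneg, ?_, CFC.rpow_mul_rpow_neg _,
      CFC.rpow_neg_mul_rpow _⟩
    rw [← CFC.rpow_add hY.isUnit, add_halves, CFC.rpow_one Y hY.nonneg]
  have hK : 0 ≤ R' * X * R' := hR'.conjugate_nonneg hX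
  have hK1 : R' * X * R' ≤ 1 := by
    have := hR'.conjugate_le_conjugate hXY
    rwa [← hRR, ← mul_assoc, h2, one_mul, h1] at this
  have hXK : X = R * (R' * X * R') * R := by
    calc X = (R * R') * X * (R' * R) := by rw [h1, h2]; simp
      _ = _ := by simp only [mul_assoc]
  have hcR : ‖compound k R‖ * ‖compound k R‖ = ‖compound k Y‖ := by
    rw [← CStarRing.norm_star_mul_self, star_eq_conjTranspose, ← compound_conjTranspose,
      ← star_eq_conjTranspose, hR.star_eq, ← compound_mul, hRR]
  rw [hXK, compound_mul, compound_mul, ← hcR]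
  refine (norm_mul₃_le ..).trans ?_
  exact mul_le_mul_of_nonneg_right
    (mul_le_of_le_one_right (norm_nonneg _) (norm_compound_le_one hK hK1)) (norm_nonneg _)

lemma norm_compound_mono {X Y : Matrix (Fin n) (Fin n) ℂ} (hX : 0 ≤ X) (hXY : X ≤ Y) :
    ‖compound k X‖ ≤ ‖compound k Y‖ := by
  have hY : 0 ≤ Y := hX.trans hXY
  have hcont : Continuous fun ε : ℝ => ‖compound k (Y + algebraMap ℝ _ ε)‖ :=
    (continuous_compound.comp (by fun_prop)).norm
  have ht := (hcont.tendsto 0).mono_left (nhdsWithin_le_nhds (s := Set.Ioi 0))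
  rw [map_zero, add_zero] at ht
  refine ge_of_tendsto ht ?_
  filter_upwards [self_mem_nhdsWithin] with ε hε
  exact norm_compound_le_of_isStrictlyPositive hX
    (CStarAlgebra.isStrictlyPositive_add_algebraMap Y hY hε)
    (hXY.trans (le_add_of_nonneg_right (algebraMap_nonneg _ (le_of_lt hε))))

lemma norm_compound_rpow {X : Matrix (Fin n) (Fin n) ℂ} (hX : 0 ≤ X) {p : ℝ} (hp : 0 < p) :
    ‖compound k (X ^ p)‖ = ‖compound k X‖ ^ p := by
  rw [compound_rpow (nonneg_iff_posSemidef.1 hX), CFC.norm_rpow _ hp (compound_nonneg hX)]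

variable (Φ : Matrix (Fin n) (Fin n) ℂ →ₚ[ℂ] Matrix (Fin n) (Fin n) ℂ)

/-- An Araki–Lieb–Thirring inequality for compound matrices. -/
lemma norm_compound_mul_mul_rpow_le {A C : Matrix (Fin n) (Fin n) ℂ} (hA : 0 ≤ A) (hC : 0 ≤ C)
    {p : ℝ} (hp : 1 ≤ p) :
    ‖compound k ((A * C * A) ^ p)‖ ≤ ‖compound k (A ^ p * C ^ p * A ^ p)‖ := by
  have hp0 : 0 < p := by linarith
  have hACA : 0 ≤ A * C * A := (IsSelfAdjoint.of_nonneg hA).conjugate_nonneg hC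
  -- Cordes will be used with exponent `p⁻¹ ≤ 1` on the compounds of `A ^ p` and `C ^ p`.
  have hinv : ∀ {X : Matrix (Fin n) (Fin n) ℂ}, 0 ≤ X →
      compound k X = compound k (X ^ p) ^ p⁻¹ := by
    intro X hX
    rw [← compound_rpow (nonneg_iff_posSemidef.1 CFC.rpow_nonneg),
      CFC.rpow_rpow_of_exponent_nonneg X p p⁻¹ hp0.le (by positivity) hX,
      mul_inv_cancel₀ hp0.ne', CFC.rpow_one X hX]
  rw [norm_compound_rpow hACA hp0, compound_mul, compound_mul, hinv hA, hinv hC, compound_mul,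
    compound_mul]
  calc _ ≤ (‖compound k (A ^ p) * compound k (C ^ p) * compound k (A ^ p)‖ ^ p⁻¹) ^ p := by
        gcongr
        exact CStarAlgebra.norm_rpow_mul_rpow_mul_rpow_le (compound_nonneg CFC.rpow_nonneg)
          (compound_nonneg CFC.rpow_nonneg) (by positivity) (inv_le_one_of_one_le₀ hp)
    _ = _ := by rw [← Real.rpow_mul (norm_nonneg _), inv_mul_cancel₀ hp0.ne', Real.rpow_one]

lemma norm_compound_mul_map_mul_rpow_le_of_le_two (hΦ : Φ 1 ≤ 1) {A B : Matrix (Fin n) (Fin n) ℂ}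
    (hA : 0 ≤ A) (hB : 0 ≤ B) {p : ℝ} (hp : 1 ≤ p) (hp2 : p ≤ 2) :
    ‖compound k ((A * Φ B * A) ^ p)‖ ≤ ‖compound k (A ^ p * Φ (B ^ p) * A ^ p)‖ := by
  have hsa : IsSelfAdjoint (A ^ p) := IsSelfAdjoint.of_nonneg CFC.rpow_nonneg
  exact (norm_compound_mul_mul_rpow_le hA (map_nonneg Φ hB) hp).trans
    (norm_compound_mono (hsa.conjugate_nonneg CFC.rpow_nonneg) (hsa.conjugate_le_conjugate
      (rpow_map_le_map_rpow Φ hΦ (nonneg_iff_posSemidef.1 hB) hp hp2)))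

lemma norm_compound_mul_map_mul_rpow_le_of_le_two_pow (hΦ : Φ 1 ≤ 1) (m : ℕ) :
    ∀ {A B : Matrix (Fin n) (Fin n) ℂ}, 0 ≤ A → 0 ≤ B → ∀ {p : ℝ}, 1 ≤ p → p ≤ 2 ^ m →
      ‖compound k ((A * Φ B * A) ^ p)‖ ≤ ‖compound k (A ^ p * Φ (B ^ p) * A ^ p)‖ := by
  induction m with
  | zero =>
    intro A B hA hB p hp hpm
    exact norm_compound_mul_map_mul_rpow_le_of_le_two Φ hΦ hA hB hp (hpm.trans (by norm_num))
  | succ m ih =>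
    intro A B hA hB p hp hpm
    rcases le_total p 2 with hp2 | hp2
    · exact norm_compound_mul_map_mul_rpow_le_of_le_two Φ hΦ hA hB hp hp2
    have hconj : ∀ {X Y : Matrix (Fin n) (Fin n) ℂ}, 0 ≤ X → 0 ≤ Y → 0 ≤ X * Φ Y * X :=
      fun hX hY => (IsSelfAdjoint.of_nonneg hX).conjugate_nonneg (map_nonneg Φ hY)
    have hq : 0 < p / 2 := by linarith
    have hpq : p = p / 2 * 2 := by ring
    have hmul : ∀ {X : Matrix (Fin n) (Fin n) ℂ}, 0 ≤ X → X ^ p = (X ^ (p / 2)) ^ (2 : ℝ) :=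
      fun {X} hX => by
        rw [CFC.rpow_rpow_of_exponent_nonneg X _ _ hq.le (by norm_num) hX, ← hpq]
    rw [hmul (hconj hA hB), hmul hA, hmul hB, norm_compound_rpow CFC.rpow_nonneg two_pos]
    -- Since `2 ≤ p ≤ 2 ^ (m + 1)`, the exponent `p / 2` lies in `[1, 2 ^ m]`. The last step is the
    -- case of exponent `2`.
    calc _ ≤ ‖compound k (A ^ (p / 2) * Φ (B ^ (p / 2)) * A ^ (p / 2))‖ ^ (2 : ℝ) := by
          gcongr
          exact ih hA hB (by linarith) (by rw [pow_succ] at hpm; linarith)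
      _ = ‖compound k ((A ^ (p / 2) * Φ (B ^ (p / 2)) * A ^ (p / 2)) ^ (2 : ℝ))‖ :=
          (norm_compound_rpow (hconj CFC.rpow_nonneg CFC.rpow_nonneg) two_pos).symm
      _ ≤ _ := norm_compound_mul_map_mul_rpow_le_of_le_two Φ hΦ CFC.rpow_nonneg CFC.rpow_nonneg
          (by norm_num) le_rfl

lemma norm_compound_mul_map_mul_rpow_le (hΦ : Φ 1 ≤ 1) {A B : Matrix (Fin n) (Fin n) ℂ}
    (hA : 0 ≤ A) (hB : 0 ≤ B) {p : ℝ} (hp : 1 ≤ p) :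
    ‖compound k ((A * Φ B * A) ^ p)‖ ≤ ‖compound k (A ^ p * Φ (B ^ p) * A ^ p)‖ := by
  obtain ⟨m, hm⟩ := pow_unbounded_of_one_lt p one_lt_two
  exact norm_compound_mul_map_mul_rpow_le_of_le_two_pow Φ hΦ m hA hB hp hm.le
end
end Matrix

end

theorem mainTheorem5 (n : ℕ) (A B : Matrix (Fin n) (Fin n) ℂ)
    (hA : A.PosSemidef) (hB : B.PosSemidef) (p : ℝ) (hp : 1 ≤ p)
    (Φ : Matrix (Fin n) (Fin n) ℂ →ₚ[ℂ] Matrix (Fin n) (Fin n) ℂ) (hΦ : Φ 1 ≤ 1) :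
    Matrix.WeakLogMajorizedBy ((A * Φ B * A) ^ p) (A ^ p * Φ (B ^ p) * A ^ p) := by
  have hX : 0 ≤ (A * Φ B * A) ^ p := CFC.rpow_nonneg
  have hY : 0 ≤ A ^ p * Φ (B ^ p) * A ^ p :=
    (IsSelfAdjoint.of_nonneg CFC.rpow_nonneg).conjugate_nonneg (map_nonneg Φ CFC.rpow_nonneg)
  refine ⟨Matrix.nonneg_iff_posSemidef.1 hX, Matrix.nonneg_iff_posSemidef.1 hY, fun k _ hk => ?_⟩
  rw [← Matrix.norm_compound_eq_prodEigenvalues (Matrix.nonneg_iff_posSemidef.1 hX) hk,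
    ← Matrix.norm_compound_eq_prodEigenvalues (Matrix.nonneg_iff_posSemidef.1 hY) hk]
  exact Matrix.norm_compound_mul_map_mul_rpow_le Φ hΦ (Matrix.nonneg_iff_posSemidef.2 hA)
    (Matrix.nonneg_iff_posSemidef.2 hB) hp
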